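/- Let $A\in\mathbb{R}^{n\times n}$ be skew-symmetric, let $C_i\in\mathbb{R}^{m_i\times n}$, $i=1,\dots,N$, and let $C=\mathrm{col}(C_1,\dots,C_N)$. Assume that $(C,A)$ is observable, i.e. that $\mathrm{col}(C,CA,\dots,CA^{n-1})$ has rank $n$. For each $i$ let $\mathcal{O}_i=\mathrm{col}(C_i,C_iA,\dots,C_iA^{n-1})$, let $\nu_i=\dim\ker\mathcal{O}_i$, and let $U_i\in\mathbb{R}^{n\times\nu_i}$ be a matrix whose columns form an orthonormal basis of $\ker\mathcal{O}_i$. Put $A_{i\bar{\mathrm{o}}}=U_i^TAU_i$, $\nu=\sum_i\nu_i$, $$U=\mathrm{block\,diag}\{U_1,\dots,U_N\}\in\mathbb{R}^{Nn\times\nu},\quad A_{\bar{\mathrm{o}}}=\mathrm{block\,diag}\{A_{1\bar{\mathrm{o}}},\dots,A_{N\bar{\mathrm{o}}}\},\quad \Gamma=\mathrm{block\,diag}\{\gamma_1I_{\nu_1},\dots,\gamma_NI_{\nu_N}\},$$ where $\gamma_i>0$ for all $i$. Let $\mathcal{G}_1,\dots,\mathcal{G}_{n_0}$ be undirected graphs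 without self-loops on the node set $\{1,\dots,N\}$, each with a symmetric nonnegative weighted adjacency matrix $[a_{ij}]$ such that $a_{ii}=0$ and, for $i\neq j$, $a_{ij}>0$ if and only if $(j,i)$ is an edge, and with Laplacian $\mathcal{L}_p=[l_{ij}]$, $l_{ii}=\sum_j a_{ij}$, $l_{ij}=-a_{ij}$ for $i\ne j$. Let $\sigma:[0,\infty)\to\{1,\dots,n_0\}$ be a piecewise constant switching signal: there are $\tau>0$ and switching instants $t_0=0$, $t_{j+1}-t_j\ge\tau$, such that $\sigma$ is constant on each $[t_j,t_{j+1})$. Assume that $\mathcal{G}_{\sigma(t)}$ is jointly connected: there are a subsequence $\{t_{j_k}\}_{k\ge0}$ of the switching instants with $t_{j_0}=0$ and a $T_{\mathrm{c}}>0$ such that, for all $k\ge0$, $\tau\le t_{j_{k+1}}-t_{j_k}\le T_{\mathrm{c}}$ and the union graph $\bigcup_{t_j\in[t_{j_k},t_{j_{k+1}})}\mathcal{G}_{\sigma(t_j)}$ is connected. Then the linear switched system $$\dot\zeta(t)=\left(A_{\bar{\mathrm{o}}}-\Gamma U^T(\mathcal{L}_{\sigma(t)}\otimes I_n)U\right)\zeta(t),\qquad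 t\ge0,$$ with state $\zeta(t)\in\mathbb{R}^{\nu}$, is exponentially stable: there are constants $\kappa,\lambda>0$ such that, for every initial time $t^*\ge0$, every solution on $[t^*,\infty)$ satisfies $\|\zeta(t)\|\le\kappa e^{-\lambda(t-t^*)}\|\zeta(t^*)\|$ for all $t\ge t^*$. -/

import Mathlib

open Matrix
open scoped Kronecker

/-! ### Observability -/

/-- The observability matrix `col(C, CA, …, CA^{n-1})` of a pair `(C, A)`; its rows are indexed
by pairs (power of `A`, row of `C`). -/
def obsMatrix {n : ℕ} {p : Type*} (C : Matrix p (Fin n) ℝ) (A : Matrix (Fin n) (Fin n) ℝ) :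
    Matrix (Fin n × p) (Fin n) ℝ :=
  Matrix.of fun kr j => (C * A ^ (kr.1 : ℕ)) kr.2 j

/-- `(C, A)` is observable: the observability matrix has full column rank `n`. -/
def IsObservable {n : ℕ} {p : Type*} (C : Matrix p (Fin n) ℝ) (A : Matrix (Fin n) (Fin n) ℝ) :
    Prop :=
  (obsMatrix C A).rank = n

/-- The stacked output matrix `C = col(C₁, …, C_N)`. -/
def stackedOutput {N n : ℕ} {m : Fin N → ℕ} (C : ∀ i, Matrix (Fin (m i)) (Fin n) ℝ) :
    Matrix ((i : Fin N) × Fin (m i)) (Fin n) ℝ :=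
  Matrix.of fun r j => C r.1 r.2 j

/-- The columns of `U` form an orthonormal basis of the unobservable subspace
`ker(col(C, CA, …, CA^{n-1}))` of `(C, A)`. In particular the number `d` of columns is the
dimension of that subspace. -/
structure IsUnobservableBasis {n d : ℕ} {p : Type*} (C : Matrix p (Fin n) ℝ)
    (A : Matrix (Fin n) (Fin n) ℝ) (U : Matrix (Fin n) (Fin d) ℝ) : Prop where
  orthonormal : Uᵀ * U = 1
  range_eq : LinearMap.range U.mulVecLin = LinearMap.ker (obsMatrix C A).mulVecLin

/-! ### Graphs and switching -/

/-- An undirected graph on `V` without self-loops, with a weighted adjacency matrix `[a_ij]`: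
symmetric, nonnegative, zero on the diagonal, and `a_ij > 0` exactly on the edges. -/
structure WeightedGraph (V : Type*) where
  graph : SimpleGraph V
  weight : Matrix V V ℝ
  weight_symm : ∀ i j, weight i j = weight j i
  weight_nonneg : ∀ i j, 0 ≤ weight i j
  weight_diag : ∀ i, weight i i = 0
  weight_pos_iff : ∀ i j, i ≠ j → (0 < weight i j ↔ graph.Adj j i)

/-- The Laplacian: `l_ii = ∑ j, a_ij` and `l_ij = -a_ij` for `i ≠ j`. -/
def WeightedGraph.laplacian {V : Type*} [Fintype V] [DecidableEq V] (G : WeightedGraph V) :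
    Matrix V V ℝ :=
  Matrix.of fun i j => if i = j then ∑ k, G.weight i k else -G.weight i j

/-- `σ` (of which only the values on `[0, ∞)` matter) is a piecewise constant switching signal
with switching instants `t 0 = 0 < t 1 < …` and dwell time `τ`. -/
structure IsSwitchingSignal {P : Type*} (σ : ℝ → P) (t : ℕ → ℝ) (τ : ℝ) : Prop where
  dwell_pos : 0 < τ
  start : t 0 = 0
  dwell : ∀ j, τ ≤ t (j + 1) - t j
  const : ∀ j, ∃ p, ∀ s ∈ Set.Ico (t j) (t (j + 1)), σ s = p

/-- Joint connectivity: there is a subsequence `t (j k)` of the switching instants, starting at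
`0`, with `τ ≤ t (j (k+1)) - t (j k) ≤ Tc` for some `Tc > 0`, such that for every `k` the union of
the graphs active at the switching instants in `[t (j k), t (j (k+1)))` is connected. -/
def JointlyConnected {V P : Type*} (G : P → WeightedGraph V) (σ : ℝ → P) (t : ℕ → ℝ) (τ : ℝ) :
    Prop :=
  ∃ (j : ℕ → ℕ) (Tc : ℝ), StrictMono j ∧ t (j 0) = 0 ∧ 0 < Tc ∧
    ∀ k, τ ≤ t (j (k + 1)) - t (j k) ∧ t (j (k + 1)) - t (j k) ≤ Tc ∧
      (⨆ (r : ℕ) (_ : t r ∈ Set.Ico (t (j k)) (t (j (k + 1)))), (G (σ (t r))).graph).Connected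

/-! ### Linear time-varying systems -/

/-- `z` solves `z' = M(s) z` on `[t₀, ∞)`. The coefficient `M` is meant to be piecewise constant
and right-continuous; then solutions are continuous, their right derivative is `M(s) z(s)` at
every `s ≥ t₀`, and, as consequences, they are differentiable off the jumps of `M`. -/
structure IsSolutionFrom {ι : Type*} [Fintype ι] [DecidableEq ι] (M : ℝ → Matrix ι ι ℝ) (t₀ : ℝ)
    (z : ℝ → EuclideanSpace ℝ ι) : Prop where
  continuousOn : ContinuousOn z (Set.Ici t₀)
  hasDeriv : ∀ s, t₀ ≤ s → HasDerivWithinAt z ((M s).toEuclideanLin (z s)) (Set.Ici s) s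

/-- (Uniform) exponential stability of `z' = M(s) z`, `s ≥ 0`, in the Euclidean norm: the constants
depend neither on the initial time nor on the initial state. -/
def ExponentiallyStable {ι : Type*} [Fintype ι] [DecidableEq ι] (M : ℝ → Matrix ι ι ℝ) : Prop :=
  ∃ κ > (0 : ℝ), ∃ lam > (0 : ℝ), ∀ t₀ ≥ (0 : ℝ), ∀ z : ℝ → EuclideanSpace ℝ ι,
    IsSolutionFrom M t₀ z → ∀ s ≥ t₀, ‖z s‖ ≤ κ * Real.exp (-lam * (s - t₀)) * ‖z t₀‖

/-! ### The block matrices of the switched system -/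

section Blocks

variable {N n : ℕ} {ν : Fin N → ℕ}

/-- `U = block diag{U₁, …, U_N}`, of size `Nn × ν` with `ν = ∑ ν_i`. -/
def blockU (U : ∀ i, Matrix (Fin n) (Fin (ν i)) ℝ) :
    Matrix (Fin N × Fin n) ((i : Fin N) × Fin (ν i)) ℝ :=
  (Matrix.blockDiagonal' U).submatrix (fun p => ⟨p.1, p.2⟩) id

/-- The block diagonal matrix of the unobservable blocks. Since `T_i = [D_i U_i]`, the lower right
block of `T_iᵀ A T_i` is `U_iᵀ A U_i`. -/
def blockA (A : Matrix (Fin n) (Fin n) ℝ) (U : ∀ i, Matrix (Fin n) (Fin (ν i)) ℝ) :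
    Matrix ((i : Fin N) × Fin (ν i)) ((i : Fin N) × Fin (ν i)) ℝ :=
  Matrix.blockDiagonal' fun i => (U i)ᵀ * A * U i

/-- `Γ = block diag{γ₁ I, …, γ_N I}`. -/
def blockGamma (ν : Fin N → ℕ) (γ : Fin N → ℝ) :
    Matrix ((i : Fin N) × Fin (ν i)) ((i : Fin N) × Fin (ν i)) ℝ :=
  Matrix.blockDiagonal' fun i => γ i • (1 : Matrix (Fin (ν i)) (Fin (ν i)) ℝ)

end Blocks

/-!
In the coordinates `x i = U i ζ i`, each `x i` evolves in the unobservable subspace `K i` of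
`(C i, A)` under the skew drift `A` and the `γ i`-scaled projection to `K i` of the graph diffusion.
The energy `∑ ‖x i‖² / γ i` ignores the drift and decreases at the rate `∑ a_ij ‖x i - x j‖²`.

Suppose that little energy is lost over a long window. The drift is common to all agents, so it
preserves `‖x i - x j‖`, while diffusion can only change this distance at the expense of energy;
Grönwall's inequality makes this precise. Hence every distance stays nearly constant over the
window, and it is small if the edge `ij` is active for some time. By joint connectivity all the
`x i` are then close to each other at the initial time. As `x i ∈ K i` and observability says
`⨅ i, K i = ⊥`, all the `x i` are small, so the energy was small already. Quantitatively, the energy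
contracts by a fixed factor over each window.
-/

/-! ### Real functions with a right derivative -/

section RealFunctions

theorem image_sub_le_mul_sub_of_deriv_right_le {f f' : ℝ → ℝ} {a b c : ℝ} (hab : a ≤ b)
    (hf : ContinuousOn f (Set.Icc a b))
    (hf' : ∀ s ∈ Set.Ico a b, HasDerivWithinAt f (f' s) (Set.Ici s) s)
    (hc : ∀ s ∈ Set.Ico a b, f' s ≤ c) : f b - f a ≤ c * (b - a) := by
  have hline : ∀ s, HasDerivAt (fun s => f a + c * (s - a)) c s := fun s => by
    simpa using (((hasDerivAt_id s).sub_const a).const_mul c).const_add (f a)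
  have hb := image_le_of_deriv_right_le_deriv_boundary hf hf' (by simp) (by fun_prop)
    (fun s _ => (hline s).hasDerivWithinAt) hc (Set.right_mem_Icc.2 hab)
  linarith

theorem antitoneOn_Ici_of_deriv_right_nonpos {f f' : ℝ → ℝ} {t₀ : ℝ}
    (hf : ContinuousOn f (Set.Ici t₀))
    (hf' : ∀ s, t₀ ≤ s → HasDerivWithinAt f (f' s) (Set.Ici s) s)
    (hnonpos : ∀ s, t₀ ≤ s → f' s ≤ 0) : AntitoneOn f (Set.Ici t₀) := by
  intro a ha b _ hab
  have hsub := image_sub_le_mul_sub_of_deriv_right_le hab (hf.mono fun s hs => le_trans ha hs.1)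
    (fun s hs => hf' s (le_trans ha hs.1)) (fun s hs => hnonpos s (le_trans ha hs.1))
  linarith

/-- Grönwall's inequality with the forcing term measured by the decrease of `V`. -/
theorem le_exp_one_mul_add_of_deriv_right {f f' V V' : ℝ → ℝ} {p s h c : ℝ} (hh : 0 < h)
    (hps : p ≤ s) (hsh : s ≤ p + h) (hf : ContinuousOn f (Set.Icc p s))
    (hV : ContinuousOn V (Set.Icc p s))
    (hf' : ∀ r ∈ Set.Ico p s, HasDerivWithinAt f (f' r) (Set.Ici r) r)
    (hV' : ∀ r ∈ Set.Ico p s, HasDerivWithinAt V (V' r) (Set.Ici r) r)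
    (hnonpos : ∀ r ∈ Set.Ico p s, V' r ≤ 0) (hc : 0 ≤ c) (hfs : 0 ≤ f s)
    (hbound : ∀ r ∈ Set.Ico p s, c * V' r - f r / h ≤ f' r) :
    f p ≤ Real.exp 1 * (f s + c * (V p - V s)) := by
  set E := fun r => Real.exp ((r - p) / h)
  have hE : ∀ r, HasDerivAt E (E r * (1 / h)) r := fun r =>
    (((hasDerivAt_id r).sub_const p).div_const h).exp
  have hE_le : ∀ r ≤ s, E r ≤ Real.exp 1 := fun r hr =>
    Real.exp_le_exp.2 ((div_le_one hh).2 (by linarith))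
  have hdecr := image_sub_le_mul_sub_of_deriv_right_le (c := 0) hps
    (f := fun r => Real.exp 1 * c * V r - E r * f r)
    ((hV.const_mul _).sub (ContinuousOn.mul (by fun_prop) hf))
    (fun r hr => ((hV' r hr).const_mul _).sub ((hE r).hasDerivWithinAt.mul (hf' r hr)))
    fun r hr => by
      calc Real.exp 1 * c * V' r - (E r * (1 / h) * f r + E r * f' r)
          ≤ Real.exp 1 * c * V' r - (E r * (1 / h) * f r + E r * (c * V' r - f r / h)) := by
            gcongr
            exact hbound r hr
        _ = (Real.exp 1 - E r) * (c * V' r) := by ring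
        _ ≤ 0 := mul_nonpos_of_nonneg_of_nonpos (sub_nonneg.2 (hE_le r hr.2.le))
          (mul_nonpos_of_nonneg_of_nonpos hc (hnonpos r hr))
  have hEp : E p = 1 := by simp [E]
  have hEs : E s * f s ≤ Real.exp 1 * f s := by
    gcongr
    exact hE_le s le_rfl
  rw [hEp] at hdecr
  linarith

theorem le_pow_mul_of_forall_add_le_mul {f : ℝ → ℝ} {t₀ h ρ : ℝ} (hh : 0 ≤ h) (hρ : 0 ≤ ρ)
    (hcontr : ∀ s, t₀ ≤ s → f (s + h) ≤ ρ * f s) (q : ℕ) : f (t₀ + q * h) ≤ ρ ^ q * f t₀ := by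
  induction q with
  | zero => simp
  | succ q ih =>
    calc f (t₀ + (q + 1 : ℕ) * h) = f (t₀ + q * h + h) := by push_cast; ring_nf
      _ ≤ ρ * f (t₀ + q * h) := hcontr _ (le_add_of_nonneg_right (by positivity))
      _ ≤ ρ * (ρ ^ q * f t₀) := by gcongr
      _ = ρ ^ (q + 1) * f t₀ := by ring

theorem le_rpow_mul_of_antitoneOn_of_forall_add_le_mul {f : ℝ → ℝ} {t₀ h ρ : ℝ}
    (hf : AntitoneOn f (Set.Ici t₀)) (hh : 0 < h) (hρ : ρ ∈ Set.Ioo 0 1) (hf₀ : 0 ≤ f t₀)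
    (hcontr : ∀ s, t₀ ≤ s → f (s + h) ≤ ρ * f s) {s : ℝ} (hs : t₀ ≤ s) :
    f s ≤ ρ ^ ((s - t₀) / h - 1) * f t₀ := by
  set q := ⌊(s - t₀) / h⌋₊
  have hq : q * h ≤ s - t₀ := (le_div_iff₀ hh).1 (Nat.floor_le (div_nonneg (by linarith) hh.le))
  have hq' : (s - t₀) / h - 1 ≤ q := (Nat.sub_one_lt_floor _).le
  calc f s ≤ f (t₀ + q * h) :=
        hf (Set.mem_Ici.2 (le_add_of_nonneg_right (by positivity))) hs (by linarith)
    _ ≤ ρ ^ q * f t₀ := le_pow_mul_of_forall_add_le_mul hh.le hρ.1.le hcontr q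
    _ ≤ ρ ^ ((s - t₀) / h - 1) * f t₀ := by
      rw [← Real.rpow_natCast]
      exact mul_le_mul_of_nonneg_right
        (Real.rpow_le_rpow_of_exponent_ge hρ.1 hρ.2.le hq') hf₀

end RealFunctions

theorem exponentiallyStable_of_lyapunov {ι : Type*} [Fintype ι] [DecidableEq ι]
    {M : ℝ → Matrix ι ι ℝ} {α β h ρ : ℝ} (hα : 0 < α) (hβ : 0 < β) (hh : 0 < h)
    (hρ : ρ ∈ Set.Ioo 0 1)
    (hV : ∀ t₀ ≥ (0 : ℝ), ∀ z, IsSolutionFrom M t₀ z → ∃ V : ℝ → ℝ,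
      AntitoneOn V (Set.Ici t₀) ∧ (∀ s, t₀ ≤ s → V (s + h) ≤ ρ * V s) ∧
        ∀ s, t₀ ≤ s → V s ∈ Set.Icc (α * ‖z s‖ ^ 2) (β * ‖z s‖ ^ 2)) :
    ExponentiallyStable M := by
  obtain ⟨hρ0, hρ1⟩ := hρ
  have hκ : 0 < β / (α * ρ) := by positivity
  refine ⟨√(β / (α * ρ)), Real.sqrt_pos.2 hκ, -(Real.log ρ / (2 * h)), neg_pos.2 <|
    div_neg_of_neg_of_pos (Real.log_neg hρ0 hρ1) (by positivity), fun t₀ ht₀ z hz s hs => ?_⟩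
  obtain ⟨V, hanti, hcontr, hbounds⟩ := hV t₀ ht₀ z hz
  set E := Real.exp (-(-(Real.log ρ / (2 * h))) * (s - t₀))
  have hE : ρ ^ ((s - t₀) / h - 1) = ρ⁻¹ * E ^ 2 := by
    rw [Real.rpow_sub_one hρ0.ne', Real.rpow_def_of_pos hρ0, ← Real.exp_nat_mul, div_eq_inv_mul]
    congr 2
    push_cast
    field_simp
  have hV₀ : 0 ≤ V t₀ := le_trans (by positivity) (hbounds t₀ le_rfl).1
  have hsq : ‖z s‖ ^ 2 ≤ β / (α * ρ) * E ^ 2 * ‖z t₀‖ ^ 2 := by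
    refine le_of_mul_le_mul_left ?_ hα
    calc α * ‖z s‖ ^ 2 ≤ V s := (hbounds s hs).1
      _ ≤ ρ⁻¹ * E ^ 2 * V t₀ := hE ▸
        le_rpow_mul_of_antitoneOn_of_forall_add_le_mul hanti hh ⟨hρ0, hρ1⟩ hV₀ hcontr hs
      _ ≤ ρ⁻¹ * E ^ 2 * (β * ‖z t₀‖ ^ 2) := by
        gcongr
        exact (hbounds t₀ le_rfl).2
      _ = α * (β / (α * ρ) * E ^ 2 * ‖z t₀‖ ^ 2) := by field_simp
  refine le_of_sq_le_sq ?_ (by positivity)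
  rwa [mul_pow, mul_pow, Real.sq_sqrt hκ.le]

/-! ### Coercivity -/

section Coercivity

variable {ι H : Type*}

theorem exists_norm_le_mul_of_iInf_eq_bot [Finite ι] [NormedAddCommGroup H]
    [InnerProductSpace ℝ H] [FiniteDimensional ℝ H] {K : ι → Submodule ℝ H} (hK : ⨅ i, K i = ⊥) :
    ∃ c : ℝ, ∀ x : ι → H, (∀ i, x i ∈ K i) → ∀ d, (∀ i j, ‖x i - x j‖ ≤ d) →
      ∀ i, ‖x i‖ ≤ c * d := by
  have := Fintype.ofFinite ι
  let f : H →ₗ[ℝ] (ι → H) := LinearMap.pi fun i => ((K i)ᗮ.starProjection : H →ₗ[ℝ] H)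
  have hproj : ∀ i v, (K i)ᗮ.starProjection v = 0 ↔ v ∈ K i := fun i v => by
    rw [Submodule.starProjection_apply_eq_zero_iff, Submodule.orthogonal_orthogonal]
  have hker : LinearMap.ker f = ⊥ := by
    refine eq_bot_iff.2 fun v hv => hK ▸ Submodule.mem_iInf _ |>.2 fun i => ?_
    exact (hproj i v).1 (congrFun (LinearMap.mem_ker.1 hv) i)
  obtain ⟨c, -, hanti⟩ := f.exists_antilipschitzWith hker
  refine ⟨c, fun x hx d hd i => ?_⟩
  have hcoord : ∀ j, f (x i) j = (K j)ᗮ.starProjection (x i - x j) := fun j => by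
    rw [map_sub, (hproj j (x j)).2 (hx j), sub_zero]
    rfl
  calc ‖x i‖ ≤ c * ‖f (x i)‖ := by simpa using hanti.le_mul_dist (x i) 0
    _ ≤ c * d := by
      gcongr
      refine (pi_norm_le_iff_of_nonneg ((norm_nonneg _).trans (hd i i))).2 fun j => ?_
      rw [hcoord]
      exact ((K j)ᗮ.norm_starProjection_apply_le _).trans (hd i j)

theorem two_mul_inner_le [SeminormedAddCommGroup H] [InnerProductSpace ℝ H] (u v : H) {h : ℝ}
    (hh : 0 < h) : 2 * inner ℝ u v ≤ ‖u‖ ^ 2 / h + h * ‖v‖ ^ 2 := by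
  have hsq := norm_sub_sq_real u (h • v)
  rw [norm_smul, inner_smul_right, mul_pow, Real.norm_of_nonneg hh.le] at hsq
  have hnonneg := sq_nonneg ‖u - h • v‖
  rw [div_add' _ _ _ hh.ne', le_div_iff₀ hh]
  linarith

theorem norm_sub_le_length_mul [SeminormedAddCommGroup H] {G : SimpleGraph ι} {x : ι → H} {d : ℝ}
    (hd : ∀ i j, G.Adj i j → ‖x i - x j‖ ≤ d) {i j : ι} (p : G.Walk i j) :
    ‖x i - x j‖ ≤ p.length * d := by
  induction p with
  | nil => simp
  | @cons i k j hik p ih =>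
    calc ‖x i - x j‖ ≤ ‖x i - x k‖ + ‖x k - x j‖ := norm_sub_le_norm_sub_add_norm_sub _ _ _
      _ ≤ d + p.length * d := add_le_add (hd i k hik) ih
      _ = (p.cons hik).length * d := by rw [SimpleGraph.Walk.length_cons]; push_cast; ring

theorem norm_sub_le_card_mul_of_connected [Fintype ι] [SeminormedAddCommGroup H]
    {G : SimpleGraph ι} (hG : G.Connected) {x : ι → H} {d : ℝ} (hd₀ : 0 ≤ d)
    (hd : ∀ i j, G.Adj i j → ‖x i - x j‖ ≤ d) (i j : ι) :
    ‖x i - x j‖ ≤ Fintype.card ι * d := by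
  obtain ⟨p, hp⟩ := hG.exists_isPath i j
  refine (norm_sub_le_length_mul hd p).trans (mul_le_mul_of_nonneg_right ?_ hd₀)
  exact_mod_cast hp.length_lt.le

end Coercivity

/-! ### Diffusion on a weighted graph -/

theorem norm_sum_smul_sq_le {ι E : Type*} [SeminormedAddCommGroup E] [NormedSpace ℝ E]
    (s : Finset ι) {w : ι → ℝ} (hw : ∀ i ∈ s, 0 ≤ w i) (v : ι → E) :
    ‖∑ i ∈ s, w i • v i‖ ^ 2 ≤ (∑ i ∈ s, w i) * ∑ i ∈ s, w i * ‖v i‖ ^ 2 := by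
  calc ‖∑ i ∈ s, w i • v i‖ ^ 2 ≤ (∑ i ∈ s, w i * ‖v i‖) ^ 2 := by
        gcongr
        refine norm_sum_le_of_le _ fun i hi => ?_
        rw [norm_smul, Real.norm_of_nonneg (hw i hi)]
    _ ≤ (∑ i ∈ s, w i) * ∑ i ∈ s, w i * ‖v i‖ ^ 2 :=
      Finset.sum_sq_le_sum_mul_sum_of_sq_le_mul s hw
        (fun i hi => mul_nonneg (hw i hi) (sq_nonneg _)) fun i _ =>
          (by ring : (w i * ‖v i‖) ^ 2 = w i * (w i * ‖v i‖ ^ 2)).le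

namespace WeightedGraph

variable {ι E : Type*} [Fintype ι]

/-- The `i`-th block of `(ℒ ⊗ I) x`, where `ℒ` is the Laplacian of `G`, see `sum_laplacian_smul`. -/
def diffusion [AddCommGroup E] [Module ℝ E] (G : WeightedGraph ι) (x : ι → E) (i : ι) : E :=
  ∑ j, G.weight i j • (x i - x j)

/-- The Dirichlet form of `G`. The sum runs over ordered pairs, so each edge counts twice. -/
def disagreement [Norm E] [Sub E] (G : WeightedGraph ι) (x : ι → E) : ℝ :=
  ∑ i, ∑ j, G.weight i j * ‖x i - x j‖ ^ 2

theorem sum_weight_nonneg (G : WeightedGraph ι) (i : ι) : 0 ≤ ∑ j, G.weight i j :=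
  Finset.sum_nonneg fun j _ => G.weight_nonneg i j

theorem sum_laplacian_smul [DecidableEq ι] [AddCommGroup E] [Module ℝ E] (G : WeightedGraph ι)
    (x : ι → E) (i : ι) : ∑ j, G.laplacian i j • x j = G.diffusion x i := by
  have hentry : ∀ j, G.laplacian i j • x j
      = (if i = j then (∑ k, G.weight i k) • x j else 0) - G.weight i j • x j := fun j => by
    by_cases hij : i = j
    · subst hij
      simp [laplacian, G.weight_diag]
    · simp [laplacian, hij]
  simp_rw [diffusion, hentry, smul_sub, Finset.sum_sub_distrib]
  simp [Finset.sum_smul]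

theorem map_diffusion {F : Type*} [AddCommGroup E] [Module ℝ E] [AddCommGroup F] [Module ℝ F]
    (f : E →ₗ[ℝ] F) (G : WeightedGraph ι) (x : ι → E) (i : ι) :
    f (G.diffusion x i) = G.diffusion (fun j => f (x j)) i := by
  simp_rw [diffusion, map_sum, map_smul, map_sub]

section Seminormed

variable [SeminormedAddCommGroup E] (G : WeightedGraph ι) (x : ι → E)

theorem sum_weight_mul_norm_sq_le_disagreement (i : ι) :
    ∑ j, G.weight i j * ‖x i - x j‖ ^ 2 ≤ G.disagreement x :=
  Finset.single_le_sum (f := fun i => ∑ j, G.weight i j * ‖x i - x j‖ ^ 2)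
    (fun i _ => Finset.sum_nonneg fun j _ => mul_nonneg (G.weight_nonneg i j) (sq_nonneg _))
    (Finset.mem_univ i)

theorem weight_mul_norm_sq_le_disagreement (i j : ι) :
    G.weight i j * ‖x i - x j‖ ^ 2 ≤ G.disagreement x :=
  (Finset.single_le_sum (f := fun j => G.weight i j * ‖x i - x j‖ ^ 2)
    (fun j _ => mul_nonneg (G.weight_nonneg i j) (sq_nonneg _)) (Finset.mem_univ j)).trans
    (G.sum_weight_mul_norm_sq_le_disagreement x i)

theorem disagreement_nonneg : 0 ≤ G.disagreement x :=
  Finset.sum_nonneg fun i _ => Finset.sum_nonneg fun j _ =>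
    mul_nonneg (G.weight_nonneg i j) (sq_nonneg _)

theorem norm_diffusion_sq_le [NormedSpace ℝ E] (i : ι) :
    ‖G.diffusion x i‖ ^ 2 ≤ (∑ j, G.weight i j) * G.disagreement x :=
  (norm_sum_smul_sq_le _ (fun j _ => G.weight_nonneg i j) _).trans <|
    mul_le_mul_of_nonneg_left (G.sum_weight_mul_norm_sq_le_disagreement x i)
      (G.sum_weight_nonneg i)

end Seminormed

theorem two_mul_sum_inner_diffusion [SeminormedAddCommGroup E] [InnerProductSpace ℝ E]
    (G : WeightedGraph ι) (x : ι → E) :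
    2 * ∑ i, inner ℝ (x i) (G.diffusion x i) = G.disagreement x := by
  have hexpand : ∑ i, inner ℝ (x i) (G.diffusion x i)
      = ∑ i, ∑ j, G.weight i j * inner ℝ (x i) (x i - x j) := by
    simp_rw [diffusion, inner_sum, inner_smul_right]
  have hswap : ∑ i, ∑ j, G.weight i j * inner ℝ (x i) (x i - x j)
      = ∑ i, ∑ j, G.weight i j * inner ℝ (x j) (x j - x i) := by
    rw [Finset.sum_comm]
    simp_rw [G.weight_symm]
  have hpolar : ∀ i j, inner ℝ (x i) (x i - x j) + inner ℝ (x j) (x j - x i)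
      = ‖x i - x j‖ ^ 2 := fun i j => by
    rw [← neg_sub (x i) (x j), inner_neg_right, ← sub_eq_add_neg, ← inner_sub_left,
      real_inner_self_eq_norm_sq]
  rw [two_mul, hexpand]
  nth_rewrite 2 [hswap]
  simp_rw [← Finset.sum_add_distrib, ← mul_add, hpolar]
  rfl

end WeightedGraph

/-! ### Projected consensus flows -/

section ProjectedFlow

variable {ι H : Type*} [Fintype ι] [NormedAddCommGroup H]

/-- The Lyapunov function `∑ ‖x i‖² / γ i` of the consensus dynamics with gains `γ`. -/
noncomputable def weightedEnergy (γ : ι → ℝ) (x : ι → H) : ℝ := ∑ i, (γ i)⁻¹ * ‖x i‖ ^ 2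

theorem exists_weightedEnergy_mem_Icc {γ : ι → ℝ} (hγ : ∀ i, 0 < γ i) :
    ∃ α > 0, ∃ β > 0, ∀ x : ι → H,
      weightedEnergy γ x ∈ Set.Icc (α * ∑ i, ‖x i‖ ^ 2) (β * ∑ i, ‖x i‖ ^ 2) := by
  obtain ⟨g, hg⟩ := Finite.exists_le γ
  obtain ⟨g', hg'⟩ := Finite.exists_le fun i => (γ i)⁻¹
  refine ⟨(max g 1)⁻¹, by positivity, max g' 1, by positivity, fun x => ?_⟩
  rw [weightedEnergy, Finset.mul_sum, Finset.mul_sum]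
  refine ⟨Finset.sum_le_sum fun i _ => ?_, Finset.sum_le_sum fun i _ => ?_⟩
  · exact mul_le_mul_of_nonneg_right
      (inv_anti₀ (hγ i) ((hg i).trans (le_max_left _ _))) (sq_nonneg _)
  · exact mul_le_mul_of_nonneg_right ((hg' i).trans (le_max_left _ _)) (sq_nonneg _)

variable [InnerProductSpace ℝ H]

theorem exists_weightedEnergy_le_of_connected [FiniteDimensional ℝ H] {K : ι → Submodule ℝ H}
    (hK : ⨅ i, K i = ⊥) {γ : ι → ℝ} (hγ : ∀ i, 0 < γ i) :
    ∃ c : ℝ, ∀ G : SimpleGraph ι, G.Connected → ∀ x : ι → H, (∀ i, x i ∈ K i) → ∀ δ ≥ 0,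
      (∀ i j, G.Adj i j → ‖x i - x j‖ ^ 2 ≤ δ) → weightedEnergy γ x ≤ c * δ := by
  obtain ⟨c, hsmall⟩ := exists_norm_le_mul_of_iInf_eq_bot hK
  refine ⟨∑ i, (γ i)⁻¹ * (c * Fintype.card ι) ^ 2, fun G hG x hx δ hδ hadj => ?_⟩
  have hall : ∀ i, ‖x i‖ ≤ c * (Fintype.card ι * √δ) := hsmall x hx _ <|
    norm_sub_le_card_mul_of_connected hG (Real.sqrt_nonneg δ) fun i j hij =>
      Real.le_sqrt_of_sq_le (hadj i j hij)
  rw [weightedEnergy, Finset.sum_mul]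
  refine Finset.sum_le_sum fun i _ => ?_
  calc (γ i)⁻¹ * ‖x i‖ ^ 2 ≤ (γ i)⁻¹ * (c * (Fintype.card ι * √δ)) ^ 2 := by
        have := hγ i
        gcongr
        exact hall i
    _ = (γ i)⁻¹ * (c * Fintype.card ι) ^ 2 * δ := by
      rw [← mul_assoc c, mul_pow _ (√δ), Real.sq_sqrt hδ, ← mul_assoc]

/-- The velocity `γ i • P i ((ℒ ⊗ I) x) i` with which agent `i`, confined to the subspace `K i`
with orthogonal projection `P i`, is pulled towards its neighbours. -/
noncomputable def projectedDiffusion (K : ι → Submodule ℝ H) [∀ i, (K i).HasOrthogonalProjection]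
    (γ : ι → ℝ) (G : WeightedGraph ι) (x : ι → H) (i : ι) : H :=
  γ i • (K i).starProjection (G.diffusion x i)

theorem norm_projectedDiffusion_sq_le {K : ι → Submodule ℝ H}
    [∀ i, (K i).HasOrthogonalProjection] {γ : ι → ℝ} {g d : ℝ} (hγ : ∀ i, |γ i| ≤ g)
    {G : WeightedGraph ι} (hd : ∀ i, ∑ j, G.weight i j ≤ d) (x : ι → H) (i : ι) :
    ‖projectedDiffusion K γ G x i‖ ^ 2 ≤ g ^ 2 * (d * G.disagreement x) := by
  have hD := G.disagreement_nonneg x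
  rw [projectedDiffusion, norm_smul, mul_pow, Real.norm_eq_abs]
  gcongr
  · exact hγ i
  · calc ‖(K i).starProjection (G.diffusion x i)‖ ^ 2 ≤ ‖G.diffusion x i‖ ^ 2 := by
          gcongr
          exact (K i).norm_starProjection_apply_le _
      _ ≤ (∑ j, G.weight i j) * G.disagreement x := G.norm_diffusion_sq_le x i
      _ ≤ d * G.disagreement x := by gcongr; exact hd i

theorem norm_projectedDiffusion_sub_sq_le {K : ι → Submodule ℝ H}
    [∀ i, (K i).HasOrthogonalProjection] {γ : ι → ℝ} {g d : ℝ} (hγ : ∀ i, |γ i| ≤ g)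
    {G : WeightedGraph ι} (hd : ∀ i, ∑ j, G.weight i j ≤ d) (x : ι → H) (i j : ι) :
    ‖projectedDiffusion K γ G x i - projectedDiffusion K γ G x j‖ ^ 2
      ≤ 4 * g ^ 2 * d * G.disagreement x := by
  set u := projectedDiffusion K γ G x
  calc ‖u i - u j‖ ^ 2 ≤ (‖u i‖ + ‖u j‖) ^ 2 := by gcongr; exact norm_sub_le _ _
    _ ≤ 2 * (‖u i‖ ^ 2 + ‖u j‖ ^ 2) := add_sq_le
    _ ≤ 2 * (g ^ 2 * (d * G.disagreement x) + g ^ 2 * (d * G.disagreement x)) := by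
      gcongr <;> exact norm_projectedDiffusion_sq_le hγ hd x _
    _ = 4 * g ^ 2 * d * G.disagreement x := by ring

/-- On `[t₀, ∞)`, the agents `x i` move inside the subspaces `K i`, driven by the common linear
drift `a` and by projected diffusion along the switching graph `G`. -/
structure IsProjectedFlow (a : H →ₗ[ℝ] H) (K : ι → Submodule ℝ H)
    [∀ i, (K i).HasOrthogonalProjection] (γ : ι → ℝ) (G : ℝ → WeightedGraph ι) (t₀ : ℝ)
    (x : ℝ → ι → H) : Prop where
  continuousOn : ContinuousOn x (Set.Ici t₀)
  mem : ∀ s, t₀ ≤ s → ∀ i, x s i ∈ K i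
  hasDeriv : ∀ s, t₀ ≤ s → ∀ i, HasDerivWithinAt (fun s => x s i)
    (a (x s i) - projectedDiffusion K γ (G s) (x s) i) (Set.Ici s) s

namespace IsProjectedFlow

variable {a : H →ₗ[ℝ] H} {K : ι → Submodule ℝ H} [∀ i, (K i).HasOrthogonalProjection] {γ : ι → ℝ}
  {G : ℝ → WeightedGraph ι} {t₀ : ℝ} {x : ℝ → ι → H}

theorem continuousOn_energy (hx : IsProjectedFlow a K γ G t₀ x) :
    ContinuousOn (fun s => weightedEnergy γ (x s)) (Set.Ici t₀) :=
  continuousOn_finsetSum _ fun i _ =>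
    continuousOn_const.mul ((continuousOn_pi.1 hx.continuousOn i).norm.pow 2)

theorem hasDerivWithinAt_energy (hx : IsProjectedFlow a K γ G t₀ x)
    (ha : ∀ v, inner ℝ v (a v) = 0) (hγ : ∀ i, γ i ≠ 0) {s : ℝ} (hs : t₀ ≤ s) :
    HasDerivWithinAt (fun s => weightedEnergy γ (x s)) (-(G s).disagreement (x s))
      (Set.Ici s) s := by
  have hagent : ∀ i, HasDerivWithinAt (fun s => (γ i)⁻¹ * ‖x s i‖ ^ 2)
      (-(2 * inner ℝ (x s i) ((G s).diffusion (x s) i))) (Set.Ici s) s := fun i => by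
    refine ((hx.hasDeriv s hs i).norm_sq.const_mul (γ i)⁻¹).congr_deriv ?_
    rw [inner_sub_right, ha, projectedDiffusion, inner_smul_right,
      ← Submodule.inner_starProjection_left_eq_right,
      Submodule.starProjection_eq_self_iff.2 (hx.mem s hs i)]
    field_simp [hγ i]
    ring
  refine (HasDerivWithinAt.fun_sum (u := Finset.univ) fun i _ => hagent i).congr_deriv ?_
  rw [← WeightedGraph.two_mul_sum_inner_diffusion, Finset.sum_neg_distrib, Finset.mul_sum]

theorem antitoneOn_energy (hx : IsProjectedFlow a K γ G t₀ x)
    (ha : ∀ v, inner ℝ v (a v) = 0) (hγ : ∀ i, γ i ≠ 0) :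
    AntitoneOn (fun s => weightedEnergy γ (x s)) (Set.Ici t₀) :=
  antitoneOn_Ici_of_deriv_right_nonpos hx.continuousOn_energy
    (fun _ hs => hx.hasDerivWithinAt_energy ha hγ hs)
    fun s _ => neg_nonpos.2 ((G s).disagreement_nonneg (x s))

theorem hasDerivWithinAt_norm_sub_sq (hx : IsProjectedFlow a K γ G t₀ x)
    (ha : ∀ v, inner ℝ v (a v) = 0) {s : ℝ} (hs : t₀ ≤ s) (i j : ι) :
    HasDerivWithinAt (fun s => ‖x s i - x s j‖ ^ 2)
      (-(2 * inner ℝ (x s i - x s j) (projectedDiffusion K γ (G s) (x s) i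
        - projectedDiffusion K γ (G s) (x s) j))) (Set.Ici s) s := by
  refine ((hx.hasDeriv s hs i).sub (hx.hasDeriv s hs j)).norm_sq.congr_deriv ?_
  rw [sub_sub_sub_comm, ← map_sub, Pi.sub_apply, inner_sub_right, ha]
  ring

/-- The common drift preserves distances, so only diffusion moves two agents relative to each
other, and diffusion costs energy. -/
theorem norm_sub_sq_le (hx : IsProjectedFlow a K γ G t₀ x) (ha : ∀ v, inner ℝ v (a v) = 0)
    (hγ : ∀ i, γ i ≠ 0) {g d : ℝ} (hg : ∀ i, |γ i| ≤ g)
    (hd : ∀ s i, ∑ j, (G s).weight i j ≤ d) {h p s : ℝ} (hh : 0 < h) (hp : t₀ ≤ p)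
    (hps : p ≤ s) (hsh : s ≤ p + h) (i j : ι) :
    ‖x p i - x p j‖ ^ 2 ≤ Real.exp 1 * (‖x s i - x s j‖ ^ 2 +
      4 * g ^ 2 * d * h * (weightedEnergy γ (x p) - weightedEnergy γ (x s))) := by
  have hsub : Set.Icc p s ⊆ Set.Ici t₀ := fun r hr => hp.trans hr.1
  have hd₀ : 0 ≤ d := ((G p).sum_weight_nonneg i).trans (hd p i)
  refine le_exp_one_mul_add_of_deriv_right (f := fun s => ‖x s i - x s j‖ ^ 2) hh hps hsh
    (((continuousOn_pi.1 hx.continuousOn i).sub (continuousOn_pi.1 hx.continuousOn j)).norm.pow 2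
      |>.mono hsub) (hx.continuousOn_energy.mono hsub)
    (fun r hr => hx.hasDerivWithinAt_norm_sub_sq ha (hp.trans hr.1) i j)
    (fun r hr => hx.hasDerivWithinAt_energy ha hγ (hp.trans hr.1))
    (fun r _ => neg_nonpos.2 ((G r).disagreement_nonneg (x r))) (by positivity) (sq_nonneg _)
    fun r _ => ?_
  have hyoung := two_mul_inner_le (x r i - x r j)
    (projectedDiffusion K γ (G r) (x r) i - projectedDiffusion K γ (G r) (x r) j) hh
  have hforce := mul_le_mul_of_nonneg_left
    (norm_projectedDiffusion_sub_sq_le (K := K) hg (hd r) (x r) i j) hh.le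
  linarith

/-- If the edge `ij` is active for a time `τ` and yet little energy is lost, then `i` and `j` are
close to each other at some moment, hence throughout the window. -/
theorem norm_sub_sq_le_of_le_weight (hx : IsProjectedFlow a K γ G t₀ x)
    (ha : ∀ v, inner ℝ v (a v) = 0) (hγ : ∀ i, γ i ≠ 0) {g d : ℝ} (hg : ∀ i, |γ i| ≤ g)
    (hd : ∀ s i, ∑ j, (G s).weight i j ≤ d) {h μ τ p q : ℝ} (hh : 0 < h) (hμ : 0 < μ)
    (hτ : 0 < τ) (hp : t₀ ≤ p) (hpq : p ≤ q) (hqh : q + τ ≤ p + h) {i j : ι}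
    (hactive : ∀ s ∈ Set.Ico q (q + τ), μ ≤ (G s).weight i j) :
    ‖x p i - x p j‖ ^ 2 ≤ Real.exp 1 * ((μ * τ)⁻¹ + 4 * g ^ 2 * d * h) *
      (weightedEnergy γ (x p) - weightedEnergy γ (x (p + h))) := by
  set V := fun s => weightedEnergy γ (x s)
  set k := 4 * g ^ 2 * d * h
  have hanti : AntitoneOn V (Set.Ici t₀) := hx.antitoneOn_energy ha hγ
  have hd₀ : 0 ≤ d := ((G p).sum_weight_nonneg i).trans (hd p i)
  have hlow : ∀ s ∈ Set.Ico q (q + τ),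
      (Real.exp 1)⁻¹ * ‖x p i - x p j‖ ^ 2 - k * (V p - V (p + h)) ≤ ‖x s i - x s j‖ ^ 2 := by
    intro s hs
    have hps : p ≤ s := hpq.trans hs.1
    have hsh : s ≤ p + h := hs.2.le.trans hqh
    have hgron := (inv_mul_le_iff₀ (Real.exp_pos 1)).2
      (hx.norm_sub_sq_le ha hγ hg hd hh hp hps hsh i j)
    have hloss : k * (V p - V s) ≤ k * (V p - V (p + h)) := by
      gcongr
      exact hanti (hp.trans hps) (hp.trans (hps.trans hsh)) hsh
    linarith
  have hdrop := image_sub_le_mul_sub_of_deriv_right_le (le_add_of_nonneg_right hτ.le)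
    (hx.continuousOn_energy.mono fun s hs => hp.trans (hpq.trans hs.1))
    (fun s hs => hx.hasDerivWithinAt_energy ha hγ (hp.trans (hpq.trans hs.1)))
    fun s hs => neg_le_neg <| calc
      _ ≤ μ * ‖x s i - x s j‖ ^ 2 := mul_le_mul_of_nonneg_left (hlow s hs) hμ.le
      _ ≤ (G s).weight i j * ‖x s i - x s j‖ ^ 2 := by gcongr; exact hactive s hs
      _ ≤ (G s).disagreement (x s) := (G s).weight_mul_norm_sq_le_disagreement (x s) i j
  have hq : V q ≤ V p := hanti hp (hp.trans hpq) hpq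
  have hqτ : V (p + h) ≤ V (q + τ) :=
    hanti (hp.trans (by linarith)) (hp.trans (by linarith)) hqh
  have hμτ : (Real.exp 1)⁻¹ * ‖x p i - x p j‖ ^ 2 - k * (V p - V (p + h))
      ≤ (μ * τ)⁻¹ * (V p - V (p + h)) := by
    rw [le_inv_mul_iff₀ (mul_pos hμ hτ)]
    linarith
  rw [mul_assoc, ← inv_mul_le_iff₀ (Real.exp_pos 1), add_mul]
  linarith

end IsProjectedFlow

/-- Within any time `h`, the edges that stay active, with weight at least `μ`, during some interval
of length `τ` connect all nodes. Different edges may be active at different times. -/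
def IsPersistentlyConnected (G : ℝ → WeightedGraph ι) (μ τ h : ℝ) : Prop :=
  ∀ s ≥ (0 : ℝ), ∃ Γ : SimpleGraph ι, Γ.Connected ∧ ∀ i j, Γ.Adj i j →
    ∃ q, s ≤ q ∧ q + τ ≤ s + h ∧ ∀ r ∈ Set.Ico q (q + τ), μ ≤ (G r).weight i j

theorem exists_weightedEnergy_le_mul_sub [FiniteDimensional ℝ H] {a : H →ₗ[ℝ] H}
    {K : ι → Submodule ℝ H} {γ : ι → ℝ} {G : ℝ → WeightedGraph ι} {d h μ τ : ℝ}
    (ha : ∀ v, inner ℝ v (a v) = 0) (hK : ⨅ i, K i = ⊥) (hγ : ∀ i, 0 < γ i)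
    (hd : ∀ s i, ∑ j, (G s).weight i j ≤ d) (hh : 0 < h) (hμ : 0 < μ) (hτ : 0 < τ)
    (hG : IsPersistentlyConnected G μ τ h) :
    ∃ c, ∀ t₀ ≥ (0 : ℝ), ∀ x, IsProjectedFlow a K γ G t₀ x → ∀ s, t₀ ≤ s →
      weightedEnergy γ (x s) ≤ c * (weightedEnergy γ (x s) - weightedEnergy γ (x (s + h))) := by
  obtain ⟨g, hg⟩ := Finite.exists_le fun i => |γ i|
  obtain ⟨c, hc⟩ := exists_weightedEnergy_le_of_connected hK hγ
  have hγ₀ : ∀ i, γ i ≠ 0 := fun i => (hγ i).ne'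
  refine ⟨c * (Real.exp 1 * ((μ * τ)⁻¹ + 4 * g ^ 2 * d * h)), fun t₀ ht₀ x hx s hs => ?_⟩
  obtain ⟨Γ, hΓ, hactive⟩ := hG s (ht₀.le.trans hs)
  have : Nonempty ι := hΓ.nonempty
  have hd₀ : 0 ≤ d := ((G s).sum_weight_nonneg (Classical.arbitrary ι)).trans (hd s _)
  have hloss : weightedEnergy γ (x (s + h)) ≤ weightedEnergy γ (x s) :=
    hx.antitoneOn_energy ha hγ₀ hs (hs.trans (by linarith)) (by linarith)
  rw [mul_assoc]
  refine hc Γ hΓ (x s) (hx.mem s hs) _ (mul_nonneg (by positivity) (sub_nonneg.2 hloss))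
    fun i j hij => ?_
  obtain ⟨q, hsq, hqh, hweight⟩ := hactive i j hij
  exact hx.norm_sub_sq_le_of_le_weight ha hγ₀ hg hd hh hμ hτ hs hsq hqh hweight

theorem exists_weightedEnergy_add_le_mul [FiniteDimensional ℝ H] {a : H →ₗ[ℝ] H}
    {K : ι → Submodule ℝ H} {γ : ι → ℝ} {G : ℝ → WeightedGraph ι} {d h μ τ : ℝ}
    (ha : ∀ v, inner ℝ v (a v) = 0) (hK : ⨅ i, K i = ⊥) (hγ : ∀ i, 0 < γ i)
    (hd : ∀ s i, ∑ j, (G s).weight i j ≤ d) (hh : 0 < h) (hμ : 0 < μ) (hτ : 0 < τ)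
    (hG : IsPersistentlyConnected G μ τ h) :
    ∃ ρ ∈ Set.Ioo (0 : ℝ) 1, ∀ t₀ ≥ (0 : ℝ), ∀ x, IsProjectedFlow a K γ G t₀ x →
      ∀ s, t₀ ≤ s → weightedEnergy γ (x (s + h)) ≤ ρ * weightedEnergy γ (x s) := by
  obtain ⟨c, hc⟩ := exists_weightedEnergy_le_mul_sub ha hK hγ hd hh hμ hτ hG
  have hC : 1 < max c 2 := by simp
  refine ⟨1 - (max c 2)⁻¹, ⟨sub_pos.2 (inv_lt_one_of_one_lt₀ hC),
    sub_lt_self _ (inv_pos.2 (by linarith))⟩, fun t₀ ht₀ x hx s hs => ?_⟩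
  have hloss : weightedEnergy γ (x (s + h)) ≤ weightedEnergy γ (x s) :=
    hx.antitoneOn_energy ha (fun i => (hγ i).ne') hs (hs.trans (by linarith)) (by linarith)
  have hmax := (hc t₀ ht₀ x hx s hs).trans
    (mul_le_mul_of_nonneg_right (le_max_left c 2) (sub_nonneg.2 hloss))
  rw [← inv_mul_le_iff₀ (by linarith)] at hmax
  linarith

end ProjectedFlow

/-! ### Unobservable subspaces -/

section Observability

variable {n : ℕ} {p : Type*} {C : Matrix p (Fin n) ℝ} {A : Matrix (Fin n) (Fin n) ℝ}
  {v : Fin n → ℝ}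

theorem obsMatrix_mulVec_eq_zero_iff :
    obsMatrix C A *ᵥ v = 0 ↔ ∀ k < n, (C * A ^ k) *ᵥ v = 0 :=
  ⟨fun h k hk => funext fun r => congrFun h (⟨k, hk⟩, r),
    fun h => funext fun kr => congrFun (h kr.1 kr.1.2) kr.2⟩

theorem mul_pow_mulVec_eq_zero_of_obsMatrix (h : obsMatrix C A *ᵥ v = 0) (k : ℕ) :
    (C * A ^ k) *ᵥ v = 0 := by
  rcases Nat.eq_zero_or_pos n with rfl | hn
  · rw [Subsingleton.elim v 0, mulVec_zero]
  have hcharpoly : A.charpoly.natDegree = n := by simp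
  have hdeg : (Polynomial.X ^ k %ₘ A.charpoly).natDegree < n := by
    conv_rhs => rw [← hcharpoly]
    refine Polynomial.natDegree_modByMonic_lt _ A.charpoly_monic fun hone => ?_
    rw [hone, Polynomial.natDegree_one] at hcharpoly
    exact hn.ne hcharpoly
  -- Cayley–Hamilton
  rw [A.pow_eq_aeval_mod_charpoly, Polynomial.aeval_eq_sum_range' hdeg, Matrix.mul_sum,
    Matrix.sum_mulVec]
  refine Finset.sum_eq_zero fun l hl => ?_
  rw [Matrix.mul_smul, Matrix.smul_mulVec,
    obsMatrix_mulVec_eq_zero_iff.1 h l (Finset.mem_range.1 hl), smul_zero]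

theorem obsMatrix_mulVec_mulVec_eq_zero (h : obsMatrix C A *ᵥ v = 0) :
    obsMatrix C A *ᵥ (A *ᵥ v) = 0 := by
  refine obsMatrix_mulVec_eq_zero_iff.2 fun k _ => ?_
  rw [mulVec_mulVec, Matrix.mul_assoc, ← pow_succ]
  exact mul_pow_mulVec_eq_zero_of_obsMatrix h (k + 1)

theorem IsObservable.eq_zero (hobs : IsObservable C A) (h : obsMatrix C A *ᵥ v = 0) : v = 0 := by
  have hrank : Module.finrank ℝ (LinearMap.range (obsMatrix C A).mulVecLin) = n := hobs
  have hnullity := (obsMatrix C A).mulVecLin.finrank_range_add_finrank_ker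
  rw [hrank, Module.finrank_fin_fun, Nat.add_eq_left, Submodule.finrank_eq_zero] at hnullity
  exact (LinearMap.ker_eq_bot'.1 hnullity) v h

theorem obsMatrix_stackedOutput_mulVec_eq_zero {N : ℕ} {m : Fin N → ℕ}
    {C : ∀ i, Matrix (Fin (m i)) (Fin n) ℝ} (h : ∀ i, obsMatrix (C i) A *ᵥ v = 0) :
    obsMatrix (stackedOutput C) A *ᵥ v = 0 :=
  funext fun kr => congrFun (h kr.2.1) (kr.1, kr.2.2)

namespace IsUnobservableBasis

variable {d : ℕ} {U : Matrix (Fin n) (Fin d) ℝ}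

theorem obsMatrix_mulVec_mulVec (hU : IsUnobservableBasis C A U) (u : Fin d → ℝ) :
    obsMatrix C A *ᵥ (U *ᵥ u) = 0 :=
  hU.range_eq.le ⟨u, rfl⟩

theorem mul_transpose_mul_mul (hU : IsUnobservableBasis C A U) : U * (Uᵀ * A * U) = A * U := by
  refine Matrix.ext_of_mulVec_single fun k => ?_
  obtain ⟨u, hu⟩ : A *ᵥ (U *ᵥ Pi.single k 1) ∈ LinearMap.range U.mulVecLin :=
    hU.range_eq.ge (obsMatrix_mulVec_mulVec_eq_zero (hU.obsMatrix_mulVec_mulVec _))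
  rw [mulVecLin_apply, mulVec_mulVec] at hu
  rw [Matrix.mul_assoc, ← Matrix.mul_assoc, ← mulVec_mulVec, ← mulVec_mulVec, ← hu,
    mulVec_mulVec u, hU.orthonormal, one_mulVec]

end IsUnobservableBasis

theorem iInf_range_toEuclideanLin_eq_bot {N : ℕ} {m ν : Fin N → ℕ}
    {C : ∀ i, Matrix (Fin (m i)) (Fin n) ℝ} (hobs : IsObservable (stackedOutput C) A)
    {U : ∀ i, Matrix (Fin n) (Fin (ν i)) ℝ} (hU : ∀ i, IsUnobservableBasis (C i) A (U i)) :
    ⨅ i, LinearMap.range (U i).toEuclideanLin = ⊥ := by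
  refine eq_bot_iff.2 fun x hx => (WithLp.ofLp_eq_zero 2).1 <| hobs.eq_zero <|
    obsMatrix_stackedOutput_mulVec_eq_zero fun i => ?_
  obtain ⟨u, rfl⟩ := Submodule.mem_iInf _ |>.1 hx i
  exact (hU i).obsMatrix_mulVec_mulVec u.ofLp

end Observability

/-! ### Euclidean geometry of matrices -/

section Euclidean

variable {m n : Type*} [Fintype m] [Fintype n] [DecidableEq n]

theorem inner_toEuclideanLin_right [DecidableEq m] (M : Matrix m n ℝ) (x : EuclideanSpace ℝ m)
    (y : EuclideanSpace ℝ n) :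
    inner ℝ x (M.toEuclideanLin y) = inner ℝ (Mᵀ.toEuclideanLin x) y := by
  rw [← conjTranspose_eq_transpose_of_trivial, toEuclideanLin_conjTranspose_eq_adjoint,
    LinearMap.adjoint_inner_left]

theorem inner_toEuclideanLin_self_eq_zero {A : Matrix n n ℝ} (hA : Aᵀ = -A)
    (x : EuclideanSpace ℝ n) : inner ℝ x (A.toEuclideanLin x) = 0 := by
  have hskew := inner_toEuclideanLin_right A x x
  rw [hA, map_neg, LinearMap.neg_apply, inner_neg_left, real_inner_comm x] at hskew
  linarith

theorem norm_toEuclideanLin_of_transpose_mul_self {U : Matrix m n ℝ} (hU : Uᵀ * U = 1)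
    (x : EuclideanSpace ℝ n) : ‖U.toEuclideanLin x‖ = ‖x‖ := by
  classical
  have hinner : inner ℝ (U.toEuclideanLin x) (U.toEuclideanLin x) = inner ℝ x x := by
    rw [inner_toEuclideanLin_right, ← LinearMap.comp_apply, ← toLpLin_mul_same, hU, toLpLin_one,
      LinearMap.id_apply]
  rwa [real_inner_self_eq_norm_sq, real_inner_self_eq_norm_sq, sq_eq_sq₀ (norm_nonneg _)
    (norm_nonneg _)] at hinner

theorem starProjection_range_toEuclideanLin [DecidableEq m] {U : Matrix m n ℝ} (hU : Uᵀ * U = 1)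
    (x : EuclideanSpace ℝ m) :
    (LinearMap.range U.toEuclideanLin).starProjection x = (U * Uᵀ).toEuclideanLin x := by
  refine Submodule.eq_starProjection_of_mem_of_inner_eq_zero
    ⟨Uᵀ.toEuclideanLin x, by rw [toLpLin_mul_same, LinearMap.comp_apply]⟩ ?_
  rintro _ ⟨y, rfl⟩
  rw [inner_toEuclideanLin_right, map_sub, ← LinearMap.comp_apply, ← toLpLin_mul_same,
    ← Matrix.mul_assoc, hU, Matrix.one_mul, sub_self, inner_zero_left]

end Euclidean

/-! ### Block matrices -/

section BlockProj

variable {ι R : Type*} {k : ι → Type*} [DecidableEq ι] [∀ i, DecidableEq (k i)]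

/-- The matrix of the projection of a block vector `ζ` to its `i`-th block `ζ i`. -/
def blockProj (R : Type*) [Zero R] [One R] (k : ι → Type*) [∀ i, DecidableEq (k i)] (i : ι) :
    Matrix (k i) (Σ i, k i) R :=
  (1 : Matrix (Σ i, k i) (Σ i, k i) R).submatrix (Sigma.mk i) id

variable [Fintype ι] [∀ i, Fintype (k i)]

theorem blockProj_mul [NonAssocSemiring R] {q : Type*} (M : Matrix (Σ i, k i) q R) (i : ι) :
    blockProj R k i * M = M.submatrix (Sigma.mk i) id :=
  one_submatrix_mul (Sigma.mk i) (Equiv.refl _) M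

theorem blockProj_mul_blockDiagonal' [NonAssocSemiring R] (B : ∀ i, Matrix (k i) (k i) R) (i : ι) :
    blockProj R k i * blockDiagonal' B = B i * blockProj R k i := by
  ext a ⟨j, b⟩
  rw [blockProj_mul, submatrix_apply, id_eq, Matrix.mul_apply]
  obtain rfl | hij := eq_or_ne i j
  · simp [blockProj, one_apply]
  · simp [blockProj, one_apply, blockDiagonal'_apply_ne _ _ _ hij, hij]

theorem sum_norm_blockProj_sq (z : EuclideanSpace ℝ (Σ i, k i)) :
    ∑ i, ‖(blockProj ℝ k i).toEuclideanLin z‖ ^ 2 = ‖z‖ ^ 2 := by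
  simp_rw [EuclideanSpace.norm_sq_eq, Fintype.sum_sigma]
  simp [blockProj, mulVec, dotProduct, one_apply]

end BlockProj

theorem submatrix_kronecker_one_mul {ι m q R : Type*} [Fintype ι] [Fintype m] [DecidableEq m]
    [CommSemiring R] (L : Matrix ι ι R) (X : Matrix (ι × m) q R) (i : ι) :
    ((L ⊗ₖ (1 : Matrix m m R)) * X).submatrix (Prod.mk i) id
      = ∑ j, L i j • X.submatrix (Prod.mk j) id := by
  ext a b
  simp [Matrix.mul_apply, Matrix.sum_apply, Fintype.sum_prod_type, one_apply]

section System

variable {N n : ℕ} {ν : Fin N → ℕ}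

/-- The `i`-th block row of `blockU U`, i.e. the matrix of `ζ ↦ U_i ζ_i`. -/
def blockRow (U : ∀ i, Matrix (Fin n) (Fin (ν i)) ℝ) (i : Fin N) :
    Matrix (Fin n) ((i : Fin N) × Fin (ν i)) ℝ :=
  U i * blockProj ℝ (fun i => Fin (ν i)) i

theorem submatrix_blockU (U : ∀ i, Matrix (Fin n) (Fin (ν i)) ℝ) (i : Fin N) :
    (blockU U).submatrix (Prod.mk i) id = blockRow U i := by
  ext a ⟨j, b⟩
  obtain rfl | hij := eq_or_ne i j
  · simp [blockU, blockRow, blockProj, Matrix.mul_apply, one_apply]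
  · simp [blockU, blockRow, blockProj, Matrix.mul_apply, one_apply,
      blockDiagonal'_apply_ne _ _ _ hij, hij]

theorem blockProj_mul_blockU_transpose_mul {q : Type*} (U : ∀ i, Matrix (Fin n) (Fin (ν i)) ℝ)
    (X : Matrix (Fin N × Fin n) q ℝ) (i : Fin N) :
    blockProj ℝ (fun i => Fin (ν i)) i * ((blockU U)ᵀ * X)
      = (U i)ᵀ * X.submatrix (Prod.mk i) id := by
  ext a b
  rw [blockProj_mul, submatrix_apply, Matrix.mul_apply, Fintype.sum_prod_type,
    Finset.sum_eq_single i (fun j _ hj => Finset.sum_eq_zero fun k _ => by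
      simp [blockU, blockDiagonal'_apply_ne _ _ _ hj]) (by simp)]
  simp [blockU, Matrix.mul_apply]

theorem blockRow_mul_system {p : Fin N → Type*} {A : Matrix (Fin n) (Fin n) ℝ}
    {C : ∀ i, Matrix (p i) (Fin n) ℝ} {U : ∀ i, Matrix (Fin n) (Fin (ν i)) ℝ}
    (hU : ∀ i, IsUnobservableBasis (C i) A (U i)) (γ : Fin N → ℝ) (G : WeightedGraph (Fin N))
    (i : Fin N) :
    blockRow U i * (blockA A U - blockGamma ν γ * (blockU U)ᵀ *
        (G.laplacian ⊗ₖ (1 : Matrix (Fin n) (Fin n) ℝ)) * blockU U)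
      = A * blockRow U i - γ i • (U i * (U i)ᵀ * G.diffusion (blockRow U) i) := by
  have hA : blockRow U i * blockA A U = A * blockRow U i := by
    rw [blockRow, blockA, Matrix.mul_assoc, blockProj_mul_blockDiagonal', ← Matrix.mul_assoc,
      (hU i).mul_transpose_mul_mul, Matrix.mul_assoc]
  have hΓ : blockRow U i * blockGamma ν γ = γ i • blockRow U i := by
    rw [blockRow, blockGamma, Matrix.mul_assoc, blockProj_mul_blockDiagonal', Matrix.smul_mul,
      Matrix.one_mul, Matrix.mul_smul]
  have hL : ((G.laplacian ⊗ₖ (1 : Matrix (Fin n) (Fin n) ℝ)) * blockU U).submatrix (Prod.mk i) id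
      = G.diffusion (blockRow U) i := by
    simp_rw [submatrix_kronecker_one_mul, submatrix_blockU, G.sum_laplacian_smul]
  rw [Matrix.mul_sub, hA]
  simp only [Matrix.mul_assoc]
  rw [← Matrix.mul_assoc (blockRow U i), hΓ, Matrix.smul_mul, blockRow, Matrix.mul_assoc (U i),
    blockProj_mul_blockU_transpose_mul, hL]

theorem sum_norm_blockRow_sq {U : ∀ i, Matrix (Fin n) (Fin (ν i)) ℝ} (hU : ∀ i, (U i)ᵀ * U i = 1)
    (z : EuclideanSpace ℝ ((i : Fin N) × Fin (ν i))) :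
    ∑ i, ‖(blockRow U i).toEuclideanLin z‖ ^ 2 = ‖z‖ ^ 2 := by
  simp_rw [blockRow, toLpLin_mul_same, LinearMap.comp_apply,
    norm_toEuclideanLin_of_transpose_mul_self (hU _)]
  exact sum_norm_blockProj_sq z

theorem IsSolutionFrom.isProjectedFlow {p : Fin N → Type*} {A : Matrix (Fin n) (Fin n) ℝ}
    {C : ∀ i, Matrix (p i) (Fin n) ℝ} {U : ∀ i, Matrix (Fin n) (Fin (ν i)) ℝ}
    (hU : ∀ i, IsUnobservableBasis (C i) A (U i)) {γ : Fin N → ℝ} {G : ℝ → WeightedGraph (Fin N)}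
    {t₀ : ℝ} {z : ℝ → EuclideanSpace ℝ ((i : Fin N) × Fin (ν i))}
    (hz : IsSolutionFrom (fun s => blockA A U - blockGamma ν γ * (blockU U)ᵀ *
      ((G s).laplacian ⊗ₖ (1 : Matrix (Fin n) (Fin n) ℝ)) * blockU U) t₀ z) :
    IsProjectedFlow A.toEuclideanLin (fun i => LinearMap.range (U i).toEuclideanLin) γ G t₀
      (fun s i => (blockRow U i).toEuclideanLin (z s)) where
  continuousOn := continuousOn_pi.2 fun i =>
    (LinearMap.continuous_of_finiteDimensional _).comp_continuousOn hz.continuousOn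
  mem s _ i := ⟨(blockProj ℝ _ i).toEuclideanLin (z s), by
    rw [blockRow, toLpLin_mul_same, LinearMap.comp_apply]⟩
  hasDeriv s hs i := by
    have hdiff : toEuclideanLin ((G s).diffusion (blockRow U) i) (z s)
        = (G s).diffusion (fun j => (blockRow U j).toEuclideanLin (z s)) i :=
      (G s).map_diffusion (LinearMap.applyₗ (z s) ∘ₗ toEuclideanLin.toLinearMap) (blockRow U) i
    refine ((blockRow U i).toEuclideanLin.toContinuousLinearMap.hasFDerivAt
      |>.comp_hasDerivWithinAt s (hz.hasDeriv s hs)).congr_deriv ?_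
    rw [LinearMap.coe_toContinuousLinearMap', ← LinearMap.comp_apply, ← toLpLin_mul_same,
      blockRow_mul_system hU, map_sub, map_smul, LinearMap.sub_apply, LinearMap.smul_apply,
      toLpLin_mul_same, toLpLin_mul_same, LinearMap.comp_apply, LinearMap.comp_apply, hdiff,
      projectedDiffusion, starProjection_range_toEuclideanLin (hU i).orthonormal]

end System

/-! ### Joint connectivity -/

theorem exists_mem_Icc_of_gaps {u : ℕ → ℝ} {τ T s : ℝ} (hτ : 0 < τ)
    (hlow : ∀ k, τ ≤ u (k + 1) - u k) (hup : ∀ k, u (k + 1) - u k ≤ T) (hs : u 0 ≤ s) :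
    ∃ k, u k ∈ Set.Icc s (s + T) := by
  classical
  have hgrow : ∀ k : ℕ, u 0 + k * τ ≤ u k := fun k => by
    induction k with
    | zero => simp
    | succ k ih =>
      push_cast
      linarith [hlow k]
  have hex : ∃ k, s ≤ u k := by
    obtain ⟨k, hk⟩ := exists_nat_ge ((s - u 0) / τ)
    exact ⟨k, by linarith [(div_le_iff₀ hτ).1 hk, hgrow k]⟩
  refine ⟨Nat.find hex, Nat.find_spec hex, ?_⟩
  rcases hk : Nat.find hex with _ | k
  · linarith [hlow 0, hup 0]
  · linarith [hup k, not_le.1 (Nat.find_min hex (hk ▸ k.lt_succ_self : k < Nat.find hex))]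

section Switching

variable {V P : Type*} {G : P → WeightedGraph V} {σ : ℝ → P} {t : ℕ → ℝ} {τ : ℝ}

theorem IsSwitchingSignal.strictMono (hσ : IsSwitchingSignal σ t τ) : StrictMono t :=
  strictMono_nat_of_lt_succ fun j => by linarith [hσ.dwell j, hσ.dwell_pos]

theorem IsSwitchingSignal.eqOn_Ico (hσ : IsSwitchingSignal σ t τ) (r : ℕ) :
    ∀ s ∈ Set.Ico (t r) (t (r + 1)), σ s = σ (t r) := fun s hs => by
  obtain ⟨p, hp⟩ := hσ.const r
  rw [hp s hs, hp (t r) ⟨le_rfl, hσ.strictMono (Nat.lt_succ_self r)⟩]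

theorem IsSwitchingSignal.exists_active_interval (hσ : IsSwitchingSignal σ t τ) {a b : ℕ} {i j : V}
    (hij : (⨆ (r : ℕ) (_ : t r ∈ Set.Ico (t a) (t b)), (G (σ (t r))).graph).Adj i j) :
    ∃ q, t a ≤ q ∧ q + τ ≤ t b ∧ ∀ s ∈ Set.Ico q (q + τ), 0 < (G (σ s)).weight i j := by
  simp only [SimpleGraph.iSup_adj] at hij
  obtain ⟨r, hr, hadj⟩ := hij
  have hrb : t (r + 1) ≤ t b := hσ.strictMono.monotone (hσ.strictMono.lt_iff_lt.1 hr.2)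
  have hdwell : t r + τ ≤ t (r + 1) := by linarith [hσ.dwell r]
  refine ⟨t r, hr.1, hdwell.trans hrb, fun s hs => ?_⟩
  rw [hσ.eqOn_Ico r s ⟨hs.1, hs.2.trans_le hdwell⟩]
  exact ((G (σ (t r))).weight_pos_iff i j hadj.ne).2 hadj.symm

theorem JointlyConnected.exists_isPersistentlyConnected (hconn : JointlyConnected G σ t τ)
    (hσ : IsSwitchingSignal σ t τ) {μ : ℝ}
    (hμ : ∀ p i j, 0 < (G p).weight i j → μ ≤ (G p).weight i j) :
    ∃ h > 0, IsPersistentlyConnected (fun s => G (σ s)) μ τ h := by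
  obtain ⟨j, T, -, hj₀, hT, hwindow⟩ := hconn
  refine ⟨2 * T, by positivity, fun s hs => ?_⟩
  obtain ⟨k, hsk, hkT⟩ := exists_mem_Icc_of_gaps (u := fun k => t (j k)) hσ.dwell_pos
    (fun k => (hwindow k).1) (fun k => (hwindow k).2.1) (hj₀.le.trans hs)
  refine ⟨_, (hwindow k).2.2, fun i l hil => ?_⟩
  obtain ⟨q, hq, hqτ, hactive⟩ := hσ.exists_active_interval hil
  exact ⟨q, hsk.trans hq, by linarith [(hwindow k).2.1], fun r hr => hμ _ _ _ (hactive r hr)⟩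

end Switching

/-! ### Exponential stability -/

theorem exponentiallyStable_of_isPersistentlyConnected {N n : ℕ} {m ν : Fin N → ℕ}
    {A : Matrix (Fin n) (Fin n) ℝ} (hA : Aᵀ = -A) {C : ∀ i, Matrix (Fin (m i)) (Fin n) ℝ}
    (hobs : IsObservable (stackedOutput C) A) {U : ∀ i, Matrix (Fin n) (Fin (ν i)) ℝ}
    (hU : ∀ i, IsUnobservableBasis (C i) A (U i)) {γ : Fin N → ℝ} (hγ : ∀ i, 0 < γ i)
    {G : ℝ → WeightedGraph (Fin N)} {d h μ τ : ℝ} (hd : ∀ s i, ∑ j, (G s).weight i j ≤ d)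
    (hh : 0 < h) (hμ : 0 < μ) (hτ : 0 < τ) (hG : IsPersistentlyConnected G μ τ h) :
    ExponentiallyStable fun s =>
      blockA A U - blockGamma ν γ * (blockU U)ᵀ *
        ((G s).laplacian ⊗ₖ (1 : Matrix (Fin n) (Fin n) ℝ)) * blockU U := by
  have hskew := inner_toEuclideanLin_self_eq_zero hA
  obtain ⟨α, hα, β, hβ, hbounds⟩ :=
    exists_weightedEnergy_mem_Icc (H := EuclideanSpace ℝ (Fin n)) hγ
  obtain ⟨ρ, hρ, hcontr⟩ :=
    exists_weightedEnergy_add_le_mul (H := EuclideanSpace ℝ (Fin n)) (a := A.toEuclideanLin) hskew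
      (iInf_range_toEuclideanLin_eq_bot hobs hU) hγ hd hh hμ hτ hG
  refine exponentiallyStable_of_lyapunov hα hβ hh hρ fun t₀ ht₀ z hz => ?_
  have hflow := hz.isProjectedFlow (G := G) hU
  have hcontr_z := hcontr t₀ ht₀ _ hflow
  refine ⟨fun s => weightedEnergy γ fun i => (blockRow U i).toEuclideanLin (z s),
    hflow.antitoneOn_energy hskew fun i => (hγ i).ne', hcontr_z, fun s _ => ?_⟩
  exact sum_norm_blockRow_sq (fun i => (hU i).orthonormal) (z s) ▸ hbounds _

theorem lemma3_general {N n : ℕ} {m ν : Fin N → ℕ} {P : Type*}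
    (A : Matrix (Fin n) (Fin n) ℝ) (hA : Aᵀ = -A)
    (C : ∀ i, Matrix (Fin (m i)) (Fin n) ℝ)
    (hobs : IsObservable (stackedOutput C) A)
    (G : P → WeightedGraph (Fin N)) {μ d : ℝ} (hμ : 0 < μ)
    (hlow : ∀ p i j, 0 < (G p).weight i j → μ ≤ (G p).weight i j)
    (hdeg : ∀ p i, ∑ j, (G p).weight i j ≤ d)
    (σ : ℝ → P) (t : ℕ → ℝ) (τ : ℝ)
    (hσ : IsSwitchingSignal σ t τ)
    (hconn : JointlyConnected G σ t τ)
    (U : ∀ i, Matrix (Fin n) (Fin (ν i)) ℝ)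
    (hU : ∀ i, IsUnobservableBasis (C i) A (U i))
    (γ : Fin N → ℝ) (hγ : ∀ i, 0 < γ i) :
    ExponentiallyStable fun s =>
      blockA A U - blockGamma ν γ * (blockU U)ᵀ *
        ((G (σ s)).laplacian ⊗ₖ (1 : Matrix (Fin n) (Fin n) ℝ)) * blockU U := by
  obtain ⟨h, hh, hG⟩ := hconn.exists_isPersistentlyConnected hσ hlow
  exact exponentiallyStable_of_isPersistentlyConnected hA hobs hU hγ (fun s => hdeg (σ s)) hh hμ
    hσ.dwell_pos hG

theorem exists_pos_le_of_pos {α : Type*} [Finite α] (f : α → ℝ) :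
    ∃ μ > (0 : ℝ), ∀ a, 0 < f a → μ ≤ f a := by
  obtain ⟨⟨μ, hμ⟩, hle⟩ :=
    Finite.exists_ge fun a : {a // 0 < f a} => (⟨f a, a.2⟩ : Set.Ioi (0 : ℝ))
  exact ⟨μ, hμ, fun a ha => hle ⟨a, ha⟩⟩

theorem lemma3 {N n n₀ : ℕ} {m ν : Fin N → ℕ}
    (A : Matrix (Fin n) (Fin n) ℝ) (hA : Aᵀ = -A)
    (C : ∀ i, Matrix (Fin (m i)) (Fin n) ℝ)
    (hobs : IsObservable (stackedOutput C) A)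
    (G : Fin n₀ → WeightedGraph (Fin N))
    (σ : ℝ → Fin n₀) (t : ℕ → ℝ) (τ : ℝ)
    (hσ : IsSwitchingSignal σ t τ)
    (hconn : JointlyConnected G σ t τ)
    (U : ∀ i, Matrix (Fin n) (Fin (ν i)) ℝ)
    (hU : ∀ i, IsUnobservableBasis (C i) A (U i))
    (γ : Fin N → ℝ) (hγ : ∀ i, 0 < γ i) :
    ExponentiallyStable fun s =>
      blockA A U - blockGamma ν γ * (blockU U)ᵀ *
        ((G (σ s)).laplacian ⊗ₖ (1 : Matrix (Fin n) (Fin n) ℝ)) * blockU U := by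
  obtain ⟨μ, hμ, hlow⟩ := exists_pos_le_of_pos
    fun e : Fin n₀ × Fin N × Fin N => (G e.1).weight e.2.1 e.2.2
  obtain ⟨d, hdeg⟩ := Finite.exists_le fun e : Fin n₀ × Fin N => ∑ j, (G e.1).weight e.2 j
  exact lemma3_general A hA C hobs G hμ (fun p i j => hlow (p, i, j)) (fun p i => hdeg (p, i))
    σ t τ hσ hconn U hU γ hγ
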